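/- For a Banach space $X$ over $\mathbb K\in\{\mathbb R,\mathbb C\}$ with dual $X^*$ and a real number $q\ge 1$, we use the following definitions. A sequence $(x_n)_n$ in $X$ is weakly $q$-summable if $\sum_n|x^*(x_n)|^q<\infty$ for every $x^*\in X^*$. A bounded set $A\subset X$ is a Dunford–Pettis set if $\lim_n\sup_{x\in A}|x_n^*(x)|=0$ for every weakly null sequence $(x_n^*)_n$ in $X^*$. A sequence $(x_n)_n$ is $q$-Right null if it is weakly $q$-summable and $\{x_n:n\in\mathbb N\}$ is a Dunford–Pettis set. A bounded set $K\subset X^*$ is a $q$-Right set if $\lim_n\sup_{x^*\in K}|x^*(x_n)|=0$ for every $q$-Right null sequence $(x_n)_n$ in $X$. **Theorem.** Let $1<p<\infty$, let $p^*=p/(p-1)$, let $1\le q<p^*$, let $(X_n)_{n}$ be a sequence of Banach spaces, and let $X=(\bigoplus_{n}X_n)_{\ell_p}$. For each $n$ let $P_n:X^*\to X_n^*$ be the $n$-th coordinate projection, where $X^*$ is identified with $(\bigoplus_n X_n^*)_{\ell_{p^*}}$ in the canonical way; that is, $(P_nx^*)(u)=x^*(0,\dots,0,u,0,\dots)$ with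 $u\in X_n$ in the $n$-th place. Then a bounded subset $K$ of $X^*$ is a $q$-Right set if and only if $P_n(K)$ is a $q$-Right set in $X_n^*$ for every $n$. -/

import Mathlib

open Filter Topology
open scoped ENNReal

noncomputable section

namespace RightSets

variable {𝕜 : Type*} [RCLike 𝕜] {X : Type*} [NormedAddCommGroup X] [NormedSpace 𝕜 X]

/-- A sequence in a normed space is weakly null if every continuous linear functional
maps it to a null sequence of scalars. -/
def IsWeaklyNull (𝕜 : Type*) [RCLike 𝕜] {X : Type*} [NormedAddCommGroup X] [NormedSpace 𝕜 X]
    (x : ℕ → X) : Prop :=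
  ∀ f : StrongDual 𝕜 X, Tendsto (fun n => f (x n)) atTop (𝓝 0)

/-- A subset `A` of `X` is a Dunford-Pettis set if it is bounded and every weakly null sequence
in the dual of `X` (weakly null with respect to the bidual) converges to zero uniformly on `A`. -/
def IsDunfordPettisSet (𝕜 : Type*) [RCLike 𝕜] {X : Type*} [NormedAddCommGroup X]
    [NormedSpace 𝕜 X] (A : Set X) : Prop :=
  Bornology.IsBounded A ∧
    ∀ f : ℕ → StrongDual 𝕜 X, IsWeaklyNull 𝕜 f →
      TendstoUniformlyOn (fun n x => f n x) (fun _ => (0 : 𝕜)) atTop A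

/-- For a real exponent `1 ≤ q`: the sequence `x` is weakly `q`-summable if the scalar sequence
`f (x n)` belongs to `ℓ_q` for every `f` in the dual of `X`. -/
def IsWeaklySummable (𝕜 : Type*) [RCLike 𝕜] {X : Type*} [NormedAddCommGroup X]
    [NormedSpace 𝕜 X] (q : ℝ) (x : ℕ → X) : Prop :=
  ∀ f : StrongDual 𝕜 X, Summable fun n => ‖f (x n)‖ ^ q

/-- A sequence is `q`-Right null if it is weakly `q`-summable and its set of terms is a
Dunford-Pettis set. -/
def IsRightNull (𝕜 : Type*) [RCLike 𝕜] {X : Type*} [NormedAddCommGroup X]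
    [NormedSpace 𝕜 X] (q : ℝ) (x : ℕ → X) : Prop :=
  IsDunfordPettisSet 𝕜 (Set.range x) ∧ IsWeaklySummable 𝕜 q x

/-- A subset `K` of the dual of `X` is a `q`-Right set if it is bounded and every `q`-Right null
sequence of `X` converges to zero uniformly on `K`. -/
def IsRightSet (q : ℝ) (K : Set (StrongDual 𝕜 X)) : Prop :=
  Bornology.IsBounded K ∧
    ∀ x : ℕ → X, IsRightNull 𝕜 q x →
      TendstoUniformlyOn (fun n (f : StrongDual 𝕜 X) => f (x n)) (fun _ => (0 : 𝕜)) atTop K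

/-- The `n`-th coordinate projection from the dual of the `ℓ_p`-sum of the `X k` to the dual of
`X n`: a functional `f` is sent to its `n`-th coordinate, the functional `u ↦ f (0, …, 0, u, 0, …)`
with `u` in position `n`. Under the canonical identification of the dual of the `ℓ_p`-sum with
the `ℓ_{p*}`-sum of the duals, `(f k)` acting by `x ↦ ∑ f k (x k)`, it is the projection to the
`n`-th coordinate; see `hasSum_dualProj`. -/
def dualProj {X : ℕ → Type*} [∀ n, NormedAddCommGroup (X n)] [∀ n, NormedSpace 𝕜 (X n)]
    {p : ℝ≥0∞} [Fact (1 ≤ p)] (n : ℕ) (f : StrongDual 𝕜 (lp X p)) : StrongDual 𝕜 (X n) :=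
  f.comp (lp.singleContinuousLinearMap 𝕜 X p n)

theorem hasSum_dualProj {X : ℕ → Type*} [∀ n, NormedAddCommGroup (X n)]
    [∀ n, NormedSpace 𝕜 (X n)] {p : ℝ≥0∞} [Fact (1 ≤ p)] (hp : p ≠ ⊤)
    (f : StrongDual 𝕜 (lp X p)) (x : lp X p) :
    HasSum (fun k => dualProj k f (x k)) (f x) :=
  f.hasSum (lp.hasSum_single hp x)

end RightSets

end

namespace RightSets

section Images

variable {𝕜 : Type*} [RCLike 𝕜] {X Y : Type*} [NormedAddCommGroup X] [NormedSpace 𝕜 X]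
  [NormedAddCommGroup Y] [NormedSpace 𝕜 Y]

/-! Restricting functionals to a coordinate is the adjoint of an inclusion, and adjoints preserve
`q`-Right sets; this is one direction. For the converse, each coordinate of a `q`-Right null
sequence is `q`-Right null, hence tends to zero uniformly on `K`. If the sequence itself does not,
`exists_gliding_hump` gives disjoint blocks and functionals `g i`, elements of `K` cut down to the
blocks, with `δ ≤ ‖g i (x (φ i))‖`. Disjointness bounds sums of `N` of the `g i` by a multiple of `N
^ (1 / p*)`. By weak `q`-summability, the `q`-th powers of the values of such a sum at the first `N`
vectors add up to `O(N ^ (q / p*))`. Averaged over all subsums, the same quantity is at least a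
constant times `N`, which is impossible since `q < p*` (`IsWeaklySummable.exists_norm_apply_lt`). -/

theorem IsWeaklyNull.map {x : ℕ → X} (hx : IsWeaklyNull 𝕜 x) (T : X →L[𝕜] Y) :
    IsWeaklyNull 𝕜 fun n => T (x n) :=
  fun f => hx (f.comp T)

theorem isBounded_image {A : Set X} (hA : Bornology.IsBounded A) (T : X →L[𝕜] Y) :
    Bornology.IsBounded (T '' A) :=
  T.lipschitz.isBounded_image hA

theorem IsDunfordPettisSet.image {A : Set X} (hA : IsDunfordPettisSet 𝕜 A) (T : X →L[𝕜] Y) :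
    IsDunfordPettisSet 𝕜 (T '' A) := by
  refine ⟨isBounded_image hA.1 T, fun f hf => ?_⟩
  have h := hA.2 (fun n => (f n).comp T)
    (hf.map ((ContinuousLinearMap.compL 𝕜 X Y 𝕜).flip T))
  rw [Metric.tendstoUniformlyOn_iff] at h ⊢
  intro ε hε
  filter_upwards [h ε hε] with n hn
  rintro _ ⟨x, hx, rfl⟩
  exact hn x hx

theorem IsRightNull.map {q : ℝ} {x : ℕ → X} (hx : IsRightNull 𝕜 q x) (T : X →L[𝕜] Y) :
    IsRightNull 𝕜 q fun n => T (x n) := by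
  refine ⟨?_, fun f => hx.2 (f.comp T)⟩
  have h := hx.1.image T
  rwa [← Set.range_comp] at h

/-- The image of a `q`-Right set under the adjoint of a continuous linear map is a
`q`-Right set. -/
theorem IsRightSet.image_comp {q : ℝ} {K : Set (StrongDual 𝕜 Y)} (hK : IsRightSet q K)
    (T : X →L[𝕜] Y) : IsRightSet q ((fun f : StrongDual 𝕜 Y => f.comp T) '' K) := by
  refine ⟨isBounded_image hK.1 ((ContinuousLinearMap.compL 𝕜 X Y 𝕜).flip T), fun x hx => ?_⟩
  have h := hK.2 _ (hx.map T)
  rw [Metric.tendstoUniformlyOn_iff] at h ⊢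
  intro ε hε
  filter_upwards [h ε hε] with n hn
  rintro _ ⟨f, hf, rfl⟩
  exact hn f hf

end Images

section WeaklySummable

variable {𝕜 : Type*} [RCLike 𝕜] {X : Type*} [NormedAddCommGroup X] [NormedSpace 𝕜 X]

theorem IsWeaklySummable.comp_injective {q : ℝ} {x : ℕ → X} (hx : IsWeaklySummable 𝕜 q x)
    {φ : ℕ → ℕ} (hφ : Function.Injective φ) : IsWeaklySummable 𝕜 q (x ∘ φ) :=
  fun f => (hx f).comp_injective hφ

/-- The `ℓ_q` sums of a weakly `q`-summable sequence are bounded uniformly on the unit ball of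
the dual. -/
theorem IsWeaklySummable.exists_bound {q : ℝ} (hq : 1 ≤ q) {x : ℕ → X}
    (hx : IsWeaklySummable 𝕜 q x) :
    ∃ C : ℝ, 0 ≤ C ∧ ∀ (f : StrongDual 𝕜 X) (N : ℕ),
      ∑ i ∈ Finset.range N, ‖f (x i)‖ ^ q ≤ (C * ‖f‖) ^ q := by
  have hq0 : 0 < q := by linarith
  have : Fact (1 ≤ ENNReal.ofReal q) := ⟨by simpa using ENNReal.ofReal_le_ofReal hq⟩
  have hqr : (ENNReal.ofReal q).toReal = q := ENNReal.toReal_ofReal hq0.le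
  -- The truncations of `f ↦ (f (x i))ᵢ` into `ℓ_q` are pointwise bounded on the dual, which is
  -- complete even if `X` is not.
  let T : ℕ → StrongDual 𝕜 X →L[𝕜] lp (fun _ : ℕ => 𝕜) (ENNReal.ofReal q) := fun N =>
    ∑ i ∈ Finset.range N,
      (lp.singleContinuousLinearMap 𝕜 (fun _ : ℕ => 𝕜) (ENNReal.ofReal q) i).comp
        (NormedSpace.inclusionInDoubleDual 𝕜 X (x i))
  have hT : ∀ N f, ‖T N f‖ ^ q = ∑ i ∈ Finset.range N, ‖f (x i)‖ ^ q := by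
    intro N f
    have h := lp.norm_sum_single (p := ENNReal.ofReal q) (by rw [hqr]; exact hq0)
      (fun i => f (x i)) (Finset.range N)
    rw [hqr] at h
    rw [← h]
    simp [T]
  obtain ⟨C, hC⟩ := banach_steinhaus (g := T) fun f => by
    refine ⟨(∑' i, ‖f (x i)‖ ^ q) ^ q⁻¹, fun N => ?_⟩
    rw [Real.le_rpow_inv_iff_of_pos (norm_nonneg _)
      (tsum_nonneg fun i => by positivity) hq0, hT]
    exact (hx f).sum_le_tsum _ fun i _ => by positivity
  refine ⟨C, (norm_nonneg _).trans (hC 0), fun f N => ?_⟩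
  rw [← hT]
  gcongr
  exact (T N).le_of_opNorm_le (hC N) f

/-- The two sums differ by `± g i x`, so they cannot both be small. -/
theorem exists_half_le_norm_sum_or {g : ℕ → StrongDual 𝕜 X} {x : X} (N : ℕ) (i : Fin N) {δ : ℝ}
    (h : δ ≤ ‖g i x‖) (S : Finset (Fin N)) :
    δ / 2 ≤ ‖(∑ j ∈ S, g j) x‖ ∨ δ / 2 ≤ ‖(∑ j ∈ symmDiff S {i}, g j) x‖ := by
  by_contra! hcon
  have key : ‖g i x‖ = ‖(∑ j ∈ symmDiff S {i}, g j) x - (∑ j ∈ S, g j) x‖ := by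
    by_cases hi : i ∈ S
    · have hS : symmDiff S {i} = S.erase i := by
        ext j; by_cases hj : j = i <;> simp [Finset.mem_symmDiff, hj, hi]
      rw [hS, ← Finset.add_sum_erase S _ hi, add_apply, sub_add_cancel_right,
        norm_neg]
    · have hS : symmDiff S {i} = insert i S := by
        ext j; by_cases hj : j = i <;> simp [Finset.mem_symmDiff, hj, hi]
      rw [hS, Finset.sum_insert hi, add_apply, add_sub_cancel_right]
  have := norm_sub_le ((∑ j ∈ symmDiff S {i}, g j) x) ((∑ j ∈ S, g j) x)
  linarith

/-- A lower bound for the average, over all sets `S ⊆ Fin N`, of `|∑_{j ∈ S} g j x| ^ q`. -/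
theorem card_mul_le_sum_norm_rpow {q : ℝ} (hq : 0 < q) {g : ℕ → StrongDual 𝕜 X} {x : X} (N : ℕ)
    (i : Fin N) {δ : ℝ} (hδ : 0 ≤ δ) (h : δ ≤ ‖g i x‖) :
    (2 : ℝ) ^ N * (δ / 2) ^ q ≤ 2 * ∑ S : Finset (Fin N), ‖(∑ j ∈ S, g j) x‖ ^ q := by
  -- Toggling the membership of `i` is an involution on the subsets of `Fin N`.
  have hflip : ∑ S : Finset (Fin N), ‖(∑ j ∈ symmDiff S {i}, g j) x‖ ^ q =
      ∑ S : Finset (Fin N), ‖(∑ j ∈ S, g j) x‖ ^ q :=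
    Equiv.sum_comp ((symmDiff_left_involutive ({i} : Finset (Fin N))).toPerm _)
      fun S => ‖(∑ j ∈ S, g j) x‖ ^ q
  have hle : ∀ S : Finset (Fin N), (δ / 2) ^ q ≤
      ‖(∑ j ∈ S, g j) x‖ ^ q + ‖(∑ j ∈ symmDiff S {i}, g j) x‖ ^ q := by
    intro S
    have h1 : 0 ≤ ‖(∑ j ∈ S, g j) x‖ ^ q := by positivity
    have h2 : 0 ≤ ‖(∑ j ∈ symmDiff S {i}, g j) x‖ ^ q := by positivity
    rcases exists_half_le_norm_sum_or N i h S with h' | h'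
    · linarith [Real.rpow_le_rpow (by positivity) h' hq.le]
    · linarith [Real.rpow_le_rpow (by positivity) h' hq.le]
  calc (2 : ℝ) ^ N * (δ / 2) ^ q = ∑ _S : Finset (Fin N), (δ / 2) ^ q := by simp
    _ ≤ _ := Finset.sum_le_sum fun S _ => hle S
    _ = _ := by rw [Finset.sum_add_distrib, hflip, two_mul]

/-- If the sums of `N` of the functionals `g j` have norm `O(N ^ r)` with `r * q < 1`, then
`g i (x i)` is not bounded away from zero for a weakly `q`-summable sequence `x`. -/
theorem IsWeaklySummable.exists_norm_apply_lt {q r M δ : ℝ} (hq : 1 ≤ q) (hr : 0 ≤ r)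
    (hrq : r * q < 1) (hδ : 0 < δ) {x : ℕ → X} (hx : IsWeaklySummable 𝕜 q x)
    {g : ℕ → StrongDual 𝕜 X} (hM : 0 ≤ M)
    (hg : ∀ S : Finset ℕ, ‖∑ j ∈ S, g j‖ ≤ M * (S.card : ℝ) ^ r) :
    ∃ i, ‖g i (x i)‖ < δ := by
  by_contra! hcon
  have hq0 : 0 < q := by linarith
  obtain ⟨C, hC0, hC⟩ := hx.exists_bound hq
  -- Double counting over pairs `(S, i)`: weak summability bounds the sum over `i` above for each
  -- `S`, and toggling bounds the sum over `S` below for each `i`. The common factor `2 ^ N`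
  -- cancels.
  have main : ∀ N : ℕ, (N : ℝ) * (δ / 2) ^ q ≤ 2 * ((C * M) ^ q * (N : ℝ) ^ (r * q)) := by
    intro N
    have hupper : ∀ S : Finset (Fin N), ∑ i : Fin N, ‖(∑ j ∈ S, g j) (x i)‖ ^ q ≤
        (C * M) ^ q * (N : ℝ) ^ (r * q) := by
      intro S
      have hnorm : ‖∑ j ∈ S, g j‖ ≤ M * (N : ℝ) ^ r := by
        have h := hg (S.map Fin.valEmbedding)
        rw [Finset.sum_map, Finset.card_map] at h
        refine h.trans ?_
        gcongr
        simpa using Finset.card_le_univ S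
      rw [Fin.sum_univ_eq_sum_range (fun i => ‖(∑ j ∈ S, g j) (x i)‖ ^ q) N]
      refine (hC _ N).trans ?_
      rw [Real.rpow_mul (by positivity), ← Real.mul_rpow (by positivity) (by positivity), mul_assoc]
      gcongr
    have hlower := Finset.sum_le_sum fun (i : Fin N) (_ : i ∈ Finset.univ) =>
      card_mul_le_sum_norm_rpow hq0 (x := x i) (g := g) N i hδ.le (hcon i)
    rw [← Finset.mul_sum, ← Finset.mul_sum, Finset.sum_comm] at hlower
    have hsum := Finset.sum_le_sum fun (S : Finset (Fin N)) (_ : S ∈ Finset.univ) => hupper S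
    simp only [Finset.sum_const, Finset.card_univ, Fintype.card_fin, Fintype.card_finset,
      nsmul_eq_mul, Nat.cast_pow, Nat.cast_ofNat] at hlower hsum
    have h2 : (0 : ℝ) < 2 ^ N := by positivity
    refine le_of_mul_le_mul_left ?_ h2
    linarith
  have hlim : Tendsto (fun N : ℕ => (N : ℝ) ^ (1 - r * q)) atTop atTop :=
    (tendsto_rpow_atTop (by linarith)).comp tendsto_natCast_atTop_atTop
  have hδq : 0 < (δ / 2) ^ q := by positivity
  obtain ⟨N, hN, hN1⟩ := ((hlim.eventually_gt_atTop (2 * (C * M) ^ q / (δ / 2) ^ q)).and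
    (eventually_ge_atTop 1)).exists
  have hN0 : (0 : ℝ) < N := by exact_mod_cast hN1
  have hpow : (0 : ℝ) < (N : ℝ) ^ (r * q) := by positivity
  rw [Real.rpow_sub hN0, Real.rpow_one, div_lt_div_iff₀ hδq hpow] at hN
  linarith [main N]

end WeaklySummable

section Blocks

variable {𝕜 : Type*} [RCLike 𝕜] {X : ℕ → Type*} [∀ n, NormedAddCommGroup (X n)]
  [∀ n, NormedSpace 𝕜 (X n)] {p : ℝ≥0∞} [Fact (1 ≤ p)]

/-- The projection of an `ℓ_p`-sum onto the coordinates in a finite set `s`. -/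
noncomputable def blockProj (𝕜 : Type*) [RCLike 𝕜] (X : ℕ → Type*) [∀ n, NormedAddCommGroup (X n)]
    [∀ n, NormedSpace 𝕜 (X n)] (p : ℝ≥0∞) [Fact (1 ≤ p)] (s : Finset ℕ) :
    lp X p →L[𝕜] lp X p :=
  ∑ k ∈ s, (lp.singleContinuousLinearMap 𝕜 X p k).comp (lp.evalCLM 𝕜 X p k)

theorem blockProj_apply (s : Finset ℕ) (x : lp X p) :
    blockProj 𝕜 X p s x = ∑ k ∈ s, lp.single p k (x k) := by
  simp only [blockProj, sum_apply]
  rfl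

theorem apply_blockProj (s : Finset ℕ) (f : StrongDual 𝕜 (lp X p)) (x : lp X p) :
    f (blockProj 𝕜 X p s x) = ∑ k ∈ s, dualProj k f (x k) := by
  rw [blockProj_apply, map_sum]
  rfl

theorem sum_norm_blockProj_rpow_le (hp : 0 < p.toReal) {s : ℕ → Finset ℕ}
    (hs : Pairwise (Function.onFun Disjoint s)) (S : Finset ℕ) (x : lp X p) :
    ∑ j ∈ S, ‖blockProj 𝕜 X p (s j) x‖ ^ p.toReal ≤ ‖x‖ ^ p.toReal := by
  simp only [blockProj_apply, lp.norm_sum_single hp (fun k => x k)]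
  rw [← Finset.sum_biUnion fun i _ j _ hij => hs hij]
  exact lp.sum_rpow_le_norm_rpow hp x _

/-- Hölder's inequality against the constant 1; the exponent is `1 / p*`. -/
theorem sum_norm_blockProj_le (hp : 1 ≤ p.toReal) {s : ℕ → Finset ℕ}
    (hs : Pairwise (Function.onFun Disjoint s)) (S : Finset ℕ) (x : lp X p) :
    ∑ j ∈ S, ‖blockProj 𝕜 X p (s j) x‖ ≤
      (S.card : ℝ) ^ ((p.toReal - 1) / p.toReal) * ‖x‖ := by
  have hp0 : 0 < p.toReal := by linarith
  have h := Real.rpow_sum_le_const_mul_sum_rpow S (fun j => ‖blockProj 𝕜 X p (s j) x‖) hp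
  simp only [abs_norm] at h
  have h' := h.trans
    (mul_le_mul_of_nonneg_left (sum_norm_blockProj_rpow_le hp0 hs S x) (by positivity))
  rw [← Real.rpow_le_rpow_iff (by positivity) (by positivity) hp0]
  rwa [Real.mul_rpow (by positivity) (by positivity), ← Real.rpow_mul (by positivity),
    div_mul_cancel₀ _ hp0.ne']

theorem norm_sum_comp_blockProj_le (hp : 1 ≤ p.toReal) {s : ℕ → Finset ℕ}
    (hs : Pairwise (Function.onFun Disjoint s)) {M : ℝ} (hM : 0 ≤ M)
    {f : ℕ → StrongDual 𝕜 (lp X p)} (hf : ∀ j, ‖f j‖ ≤ M) (S : Finset ℕ) :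
    ‖∑ j ∈ S, (f j).comp (blockProj 𝕜 X p (s j))‖ ≤
      M * (S.card : ℝ) ^ ((p.toReal - 1) / p.toReal) := by
  refine ContinuousLinearMap.opNorm_le_bound _ (by positivity) fun x => ?_
  rw [sum_apply, mul_assoc]
  refine (norm_sum_le _ _).trans ?_
  refine (Finset.sum_le_sum fun j _ => (f j).le_of_opNorm_le (hf j) _).trans ?_
  rw [← Finset.mul_sum]
  gcongr
  exact sum_norm_blockProj_le hp hs S x

theorem pairwise_disjoint_Ico_of_monotone {m : ℕ → ℕ} (hm : Monotone m) :
    Pairwise (Function.onFun Disjoint fun i => Finset.Ico (m i) (m (i + 1))) := by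
  intro i j hij
  have h := hm.pairwise_disjoint_on_Ico_succ hij
  simp only [Function.onFun, Order.succ_eq_add_one] at h ⊢
  rw [← Finset.disjoint_coe]
  simpa using h

/-- If every coordinate of the sequence `x` converges to zero uniformly on `K` but `x` does not,
then functionals in `K` are bounded below on successive blocks of a subsequence of `x`. -/
theorem exists_gliding_hump (hp : p ≠ ⊤) {K : Set (StrongDual 𝕜 (lp X p))} {x : ℕ → lp X p}
    (hcoord : ∀ k, TendstoUniformlyOn (fun n (f : StrongDual 𝕜 (lp X p)) => dualProj k f (x n k))
      (fun _ => (0 : 𝕜)) atTop K)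
    (hx : ¬ TendstoUniformlyOn (fun n (f : StrongDual 𝕜 (lp X p)) => f (x n))
      (fun _ => (0 : 𝕜)) atTop K) :
    ∃ δ > 0, ∃ (φ m : ℕ → ℕ) (f : ℕ → StrongDual 𝕜 (lp X p)), StrictMono φ ∧ Monotone m ∧
      (∀ i, f i ∈ K) ∧
      ∀ i, δ ≤ ‖f i (blockProj 𝕜 X p (Finset.Ico (m i) (m (i + 1))) (x (φ i)))‖ := by
  simp only [Metric.tendstoUniformlyOn_iff, dist_zero_left] at hcoord hx
  push Not at hx
  obtain ⟨ε, hε, hfreq⟩ := hx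
  have hhead : ∀ m : ℕ, ∀ η > 0, ∀ᶠ n in atTop, ∀ f ∈ K,
      ‖∑ k ∈ Finset.range m, dualProj k f (x n k)‖ < η := by
    intro m
    induction m with
    | zero => intro η hη; simp [hη]
    | succ m ih =>
      intro η hη
      filter_upwards [ih (η / 2) (by positivity), hcoord m (η / 2) (by positivity)]
        with n h1 h2 f hf
      rw [Finset.sum_range_succ]
      linarith [norm_add_le (∑ k ∈ Finset.range m, dualProj k f (x n k)) (dualProj m f (x n m)),
        h1 f hf, h2 f hf]
  -- The state `a` records the last index used and the end of the last block. Of the mass `ε` of `f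
  -- (x n)`, the head before `a.2` and the tail from `m'` each cost at most `ε / 4`.
  have step : ∀ a : ℕ × ℕ, ∃ n m' : ℕ, ∃ f ∈ K, a.1 < n ∧ a.2 ≤ m' ∧
      ε / 2 ≤ ‖f (blockProj 𝕜 X p (Finset.Ico a.2 m') (x n))‖ := by
    rintro ⟨n₀, m⟩
    obtain ⟨n, ⟨f, hf, hfn⟩, hn, hlt⟩ := (hfreq.and_eventually
      ((hhead m (ε / 4) (by positivity)).and (eventually_gt_atTop n₀))).exists
    have htail := (hasSum_dualProj hp f (x n)).tendsto_sum_nat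
    obtain ⟨m', hm', hmm⟩ := ((Metric.tendsto_nhds.1 htail (ε / 4) (by positivity)).and
      (eventually_ge_atTop m)).exists
    refine ⟨n, m', f, hf, hlt, hmm, ?_⟩
    rw [apply_blockProj, Finset.sum_Ico_eq_sub _ hmm]
    have h1 := hn f hf
    rw [dist_eq_norm] at hm'
    set a := ∑ k ∈ Finset.range m', dualProj k f (x n k)
    set b := ∑ k ∈ Finset.range m, dualProj k f (x n k)
    have h2 : ‖f (x n)‖ ≤ ‖a - b‖ + ‖b‖ + ‖a - f (x n)‖ := by
      calc ‖f (x n)‖ = ‖(a - b) + b - (a - f (x n))‖ := by congr 1; ring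
        _ ≤ _ := (norm_sub_le _ _).trans (by gcongr; exact norm_add_le _ _)
    linarith
  choose n m' f hfK hn hm' hle using step
  let st : ℕ → ℕ × ℕ := fun i => Nat.rec (0, 0) (fun _ a => (n a, m' a)) i
  refine ⟨ε / 2, by positivity, fun i => n (st i), fun i => (st i).2, fun i => f (st i),
    strictMono_nat_of_lt_succ fun i => hn (st (i + 1)), monotone_nat_of_le_succ fun i => hm' (st i),
    fun i => hfK _, fun i => hle (st i)⟩

end Blocks

end RightSets

theorem theorem3p21 {𝕜 : Type*} [RCLike 𝕜]
    {X : ℕ → Type*} [∀ n, NormedAddCommGroup (X n)] [∀ n, NormedSpace 𝕜 (X n)]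
    [∀ n, CompleteSpace (X n)]
    (p : ℝ≥0∞) [Fact (1 ≤ p)] (hp_one : 1 < p) (hp_top : p < ⊤)
    (q : ℝ) (hq_one : 1 ≤ q) (hq_lt : q < Real.conjExponent p.toReal)
    (K : Set (StrongDual 𝕜 (lp X p))) (hK : Bornology.IsBounded K) :
    RightSets.IsRightSet q K ↔
      ∀ n, RightSets.IsRightSet q (RightSets.dualProj n '' K) := by
  refine ⟨fun h n => h.image_comp (lp.singleContinuousLinearMap 𝕜 X p n), fun h => ⟨hK, ?_⟩⟩
  intro x hx
  by_contra hcon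
  have hp1 : 1 < p.toReal := by
    simpa using (ENNReal.toReal_lt_toReal ENNReal.one_ne_top hp_top.ne).2 hp_one
  have hcoord : ∀ k, TendstoUniformlyOn
      (fun n (f : StrongDual 𝕜 (lp X p)) => RightSets.dualProj k f (x n k))
      (fun _ => (0 : 𝕜)) atTop K := by
    intro k
    have hk := (h k).2 _ (hx.map (lp.evalCLM 𝕜 X p k))
    rw [Metric.tendstoUniformlyOn_iff] at hk ⊢
    intro ε hε
    filter_upwards [hk ε hε] with n hn f hf
    exact hn _ (Set.mem_image_of_mem _ hf)
  obtain ⟨δ, hδ, φ, m, f, hφ, hm, hfK, hle⟩ :=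
    RightSets.exists_gliding_hump hp_top.ne hcoord hcon
  obtain ⟨M, hM0, hM⟩ := hK.exists_pos_norm_le
  -- This is `q < p*` rearranged.
  have hr : (p.toReal - 1) / p.toReal * q < 1 := by
    rw [Real.conjExponent, lt_div_iff₀ (by linarith)] at hq_lt
    rw [div_mul_eq_mul_div, div_lt_one (by linarith)]
    linarith
  obtain ⟨i, hi⟩ := (hx.2.comp_injective hφ.injective).exists_norm_apply_lt hq_one
    (div_nonneg (by linarith) (by linarith)) hr hδ hM0.le
    (RightSets.norm_sum_comp_blockProj_le hp1.le (RightSets.pairwise_disjoint_Ico_of_monotone hm)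
      hM0.le fun j => hM _ (hfK j))
  exact (hle i).not_gt hi
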